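/- Let $k$ be a field, $n\ge 1$, and let $<$ be a term order on $k[X_1,\dots,X_n]$ with $X_1<\dots<X_n$; write $\overline X=(X_2,\dots,X_n)$, and restrict $<$ to the monomials in $\overline X$. For a field $K$ and an ideal $I\subset K[\overline X]$, let $C(I)\subset\mathbb N^{n-1}$ be the set of leading exponents of the nonzero elements of $I$, and let $D(I)=\mathbb N^{n-1}\setminus C(I)$ be the standard set of $I$; let $\mathbb D_{n-1}$ be the set of all $\delta\subset\mathbb N^{n-1}$ such that $\alpha\notin\delta$ implies $\alpha+\beta\notin\delta$ for all $\beta\in\mathbb N^{n-1}$. For a $d$-dimensional affine subspace $A'$ of $k^n$ (a $d$-plane, viewed as a closed subset of $\mathbb A^n=\operatorname{Spec}k[X_1,\dots,X_n]$) and $J\subset\{1,\dots,n\}$, the variables $X_j$, $j\in J$, are called free variables of $A'$ if the projection $A'\to k^J$ is bijective; they are called minimal free variables if moreover there are no $j\in J$ and $i\notin J$ with $i<j$ such that the variables with indices in $(J\setminus\{j\})\cup\{i\}$ are free variables of $A'$. Let $A\subset\mathbb A^n$ be a closed subset with ideal $I(A)$ such that every irreducible component of $A$ is a $d$-plane having $X_1$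 among its minimal free variables. For a point $\lambda\in\mathbb A^1=\operatorname{Spec}k[X_1]$ with residue field $k(\lambda)$, let $A_\lambda=A\cap\{X_1=\lambda\}\subset\mathbb A^{n-1}_{k(\lambda)}$ be the slice of $A$ over $\lambda$, i.e. the closed subset defined by the image of $I(A)$ in $k(\lambda)[\overline X]$, and let $\delta_\lambda=D(I(A_\lambda))$, where $I(A_\lambda)\subset k(\lambda)[\overline X]$ is the (radical) ideal of $A_\lambda$. Then there exist a nonempty Zariski-open set $U\subset\mathbb A^1$ and a set $\delta\in\mathbb D_{n-1}$ such that $\delta_\lambda=\delta$ for all $\lambda\in U$; moreover, $U$ can be chosen such that for all $\lambda\in U$ also the ideal of $k(\lambda)[\overline X]$ generated by the image of $I(A)$ has standard set $\delta$. (For a $k$-rational point $\lambda$ of $U$, these are statements about ideals in $k[\overline X]$.) -/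

import Mathlib

/-- The restriction of a term order on the monomials in `X_0, …, X_n` to the monomials in
`X_1, …, X_n` (i.e. in `X (Fin.succ i)`, renamed to `X i`): exponents are compared after the
inclusion `ℕⁿ → ℕⁿ⁺¹`, `α ↦ (0, α)`. -/
noncomputable def restrictOrder {n : ℕ} (m : MonomialOrder (Fin (n + 1))) :
    MonomialOrder (Fin n) where
  syn := Fin n →₀ ℕ
  addCommMonoidSyn := inferInstance
  linearOrderSyn := LinearOrder.lift' (fun α => m.toSyn (Finsupp.mapDomain Fin.succ α))
    (m.toSyn.injective.comp (Finsupp.mapDomain_injective (Fin.succ_injective n)))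
  isOrderedAddMonoid_syn := by
    let this : LinearOrder (Fin n →₀ ℕ) :=
      LinearOrder.lift' (fun α => m.toSyn (Finsupp.mapDomain Fin.succ α))
        (m.toSyn.injective.comp (Finsupp.mapDomain_injective (Fin.succ_injective n)))
    refine @IsOrderedAddMonoid.mk _ _ this.toPreorder (fun a b h c => ?_) (fun a b h c => ?_)
    · change m.toSyn (Finsupp.mapDomain Fin.succ (a + c))
        ≤ m.toSyn (Finsupp.mapDomain Fin.succ (b + c))
      rw [Finsupp.mapDomain_add, Finsupp.mapDomain_add, map_add, map_add]
      exact add_le_add_left (α := m.syn) h _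
    · change m.toSyn (Finsupp.mapDomain Fin.succ (c + a))
        ≤ m.toSyn (Finsupp.mapDomain Fin.succ (c + b))
      rw [Finsupp.mapDomain_add, Finsupp.mapDomain_add, map_add, map_add]
      exact add_le_add_right (α := m.syn) h _
  toSyn := AddEquiv.refl _
  toSyn_monotone := by
    intro a b h
    obtain ⟨c, rfl⟩ := exists_add_of_le h
    change m.toSyn (Finsupp.mapDomain Fin.succ a)
      ≤ m.toSyn (Finsupp.mapDomain Fin.succ (a + c))
    rw [Finsupp.mapDomain_add, map_add]
    exact m.le_add_right _ _
  wellFoundedLT_syn :=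
    ⟨InvImage.wf (fun α => m.toSyn (Finsupp.mapDomain Fin.succ α)) wellFounded_lt⟩

/-- The restricted order compares exponents `α` as `m` compares `(0, α)`. -/
theorem restrictOrder_le_iff {n : ℕ} (m : MonomialOrder (Fin (n + 1))) (a b : Fin n →₀ ℕ) :
    (restrictOrder m).toSyn a ≤ (restrictOrder m).toSyn b ↔
      m.toSyn (Finsupp.mapDomain Fin.succ a) ≤ m.toSyn (Finsupp.mapDomain Fin.succ b) :=
  Iff.rfl

/-- `C(I)`: the set of leading exponents of the nonzero elements of `I`. -/
def leadingExponents {σ K : Type*} [Field K] (m : MonomialOrder σ)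
    (I : Ideal (MvPolynomial σ K)) : Set (σ →₀ ℕ) :=
  {α | ∃ f ∈ I, f ≠ 0 ∧ m.degree f = α}

/-- `D(I)`: the standard set of `I`, the complement of `C(I)`. -/
def standardSet {σ K : Type*} [Field K] (m : MonomialOrder σ)
    (I : Ideal (MvPolynomial σ K)) : Set (σ →₀ ℕ) :=
  (leadingExponents m I)ᶜ

/-- `δ ∈ 𝔻`: the complement of `δ` is stable under addition of arbitrary exponents. -/
def IsStaircase {σ : Type*} (δ : Set (σ →₀ ℕ)) : Prop :=
  ∀ α, α ∉ δ → ∀ β, α + β ∉ δ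

/-- The coordinates with index in `J` are free variables of the affine subspace `P` of `kᴺ`:
they take arbitrary values on `P`, and these values determine the point of `P`. -/
def IsFreeVariables {N : ℕ} {k : Type*} [Field k] (P : AffineSubspace k (Fin N → k))
    (J : Finset (Fin N)) : Prop :=
  Function.Bijective (fun (x : P) (j : J) => (x : Fin N → k) j)

/-- `J` is the set of (indices of) minimal free variables of `P`. -/
def IsMinimalFreeVariables {N : ℕ} {k : Type*} [Field k] (P : AffineSubspace k (Fin N → k))
    (J : Finset (Fin N)) : Prop :=
  IsFreeVariables P J ∧
    ∀ j ∈ J, ∀ i, i ∉ J → i < j → ¬ IsFreeVariables P (insert i (J.erase j))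

/-- The affine subspace `P ⊆ kᴺ` as a closed subset of the scheme `𝔸ᴺ = Spec k[X]`: the common
zero locus of the polynomials of degree at most one which vanish on `P`. -/
def planeVariety {N : ℕ} {k : Type*} [Field k] (P : AffineSubspace k (Fin N → k)) :
    Set (PrimeSpectrum (MvPolynomial (Fin N) k)) :=
  PrimeSpectrum.zeroLocus {f | f.totalDegree ≤ 1 ∧ ∀ x ∈ P, MvPolynomial.eval x f = 0}

/-- `A` is a closed subset of `𝔸ⁿ⁺¹` each of whose irreducible components is a `d`-plane
that has the first coordinate (index `0`) among its minimal free variables. -/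
def IsFamilyOfPlanes {n : ℕ} {k : Type*} [Field k] (d : ℕ)
    (A : Set (PrimeSpectrum (MvPolynomial (Fin (n + 1)) k))) : Prop :=
  IsClosed A ∧ ∀ Z ∈ irreducibleComponents A,
    ∃ (P : AffineSubspace k (Fin (n + 1) → k)) (J : Finset (Fin (n + 1))),
      Subtype.val '' Z = planeVariety P ∧ Module.finrank k P.direction = d ∧
        IsMinimalFreeVariables P J ∧ 0 ∈ J

/-- The substitution of `a ∈ K` for the first variable,
`k[X_0, …, X_n] → K[X_1, …, X_n]`, where `K` is an extension field of `k`. -/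
noncomputable def substFirst (n : ℕ) (k : Type*) [Field k] {K : Type*} [Field K] [Algebra k K]
    (a : K) : MvPolynomial (Fin (n + 1)) k →ₐ[k] MvPolynomial (Fin n) K :=
  MvPolynomial.aeval (Fin.cases (MvPolynomial.C a) MvPolynomial.X)

/-- The slice `A_a = A ∩ {first coordinate = a}`, as a closed subset of `𝔸ⁿ` over `K`. -/
def slice {n : ℕ} {k : Type*} [Field k] {K : Type*} [Field K] [Algebra k K]
    (A : Set (PrimeSpectrum (MvPolynomial (Fin (n + 1)) k))) (a : K) :
    Set (PrimeSpectrum (MvPolynomial (Fin n) K)) :=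
  PrimeSpectrum.comap (substFirst n k a).toRingHom ⁻¹' A

/-- `δ_a = D(A_a)`: the standard set of the radical ideal `I(A_a)` of the slice, with respect to
the restricted term order. -/
def sliceStandardSet {n : ℕ} {k : Type*} [Field k] {K : Type*} [Field K] [Algebra k K]
    (m : MonomialOrder (Fin (n + 1)))
    (A : Set (PrimeSpectrum (MvPolynomial (Fin (n + 1)) k))) (a : K) : Set (Fin n →₀ ℕ) :=
  standardSet (restrictOrder m) (PrimeSpectrum.vanishingIdeal (slice A a))

/-- The standard set of the ideal of `K[X_1, …, X_n]` generated by the image of `I(A)` under the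
substitution of `a` for the first variable, i.e. of the scheme-theoretic fibre. -/
def fibreStandardSet {n : ℕ} {k : Type*} [Field k] {K : Type*} [Field K] [Algebra k K]
    (m : MonomialOrder (Fin (n + 1)))
    (A : Set (PrimeSpectrum (MvPolynomial (Fin (n + 1)) k))) (a : K) : Set (Fin n →₀ ℕ) :=
  standardSet (restrictOrder m)
    ((PrimeSpectrum.vanishingIdeal A).map (substFirst n k a).toRingHom)

/-- The value of the coordinate of `𝔸¹ = Spec k[T]` at the point `p`, in its residue field. -/
noncomputable def coordinateAt {k : Type*} [Field k] (p : PrimeSpectrum (Polynomial k)) :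
    p.asIdeal.ResidueField :=
  algebraMap (Polynomial k) p.asIdeal.ResidueField Polynomial.X

/-- The `k`-rational point of `𝔸¹ = Spec k[T]` with coordinate `c`, i.e. the ideal `(T - c)`. -/
noncomputable def rationalPoint {k : Type*} [Field k] (c : k) : PrimeSpectrum (Polynomial k) :=
  ⟨Ideal.span {Polynomial.X - Polynomial.C c},
    (Ideal.span_singleton_prime (Polynomial.X_sub_C_ne_zero c)).mpr (Polynomial.prime_X_sub_C c)⟩

/-! Put R = k[X_0], a principal ideal domain, and regard I(A) as an ideal I of S = R[X_1, …, X_n].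
The fibre over a point λ is the extension of I along R → k(λ). Two facts hold away from the zeros of
a nonzero element of R.

The standard set of the fibre is constant (`exists_standardSet_map_eq`). By Dickson's lemma,
finitely many elements of I have leading exponents generating all those of I. Where their leading
coefficients, which are polynomials in X_0, do not vanish, fraction-free division shows that
specialisation creates no new leading exponent (`leadingExponents_map_eq`).

The fibre is radical (`exists_isRadical_map`). Since X_0 is free on each plane, the plane is a graph
over R, and its ideal 𝔭_i is the kernel of an R-algebra retraction of S onto a subring. The
obstruction to radicality is R-torsion in the cokernel of S → ∏ S/𝔭_i, and by Noetherianity a single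
nonzero element of R kills it.

Where both hold, the fibre ideal equals I(A_λ), so both standard sets are the constant one. -/

/-! ### Fraction-free division -/

open MvPolynomial in
/-- Division with remainder for polynomials over a domain, up to multiplication by an element of a
multiplicative set containing the leading coefficients of enough elements of the ideal `I`. -/
theorem exists_remainder {σ R : Type*} [CommRing R] (m : MonomialOrder σ)
    (I : Ideal (MvPolynomial σ R)) (S : Set (σ →₀ ℕ)) (M : Submonoid R)
    (hS : ∀ α ∈ S, ∃ f ∈ I, ∃ β, α = m.degree f + β ∧ m.leadingCoeff f ∈ M) (s : WithTop m.syn) :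
    ∀ w : MvPolynomial σ R, (∀ e ∈ w.support, (m.toSyn e : WithTop m.syn) < s) →
      ∃ t ∈ M, ∃ r : MvPolynomial σ R, C t * w - r ∈ I ∧
        ∀ e ∈ r.support, e ∉ S ∧ (m.toSyn e : WithTop m.syn) < s := by
  classical
  induction s using WellFoundedLT.induction with
  | ind s ih =>
    intro w hw
    by_cases hw0 : w = 0
    · exact ⟨1, M.one_mem, 0, by simp [hw0], by simp⟩
    have hs := hw _ (m.degree_mem_support hw0)
    -- A leading term with exponent in S is cancelled after scaling by a coefficient in M; any other
    -- is moved to the remainder. Either way only exponents below that of w remain, so the induction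
    -- continues with that exponent as the new strict bound.
    by_cases hα : m.degree w ∈ S
    · obtain ⟨f, hf, β, hβ, hlc⟩ := hS _ hα
      obtain ⟨t, ht, r, hr, hr'⟩ := ih _ hs
          (C (m.leadingCoeff f) * w - monomial β (m.leadingCoeff w) * f) (by
        intro e he
        refine WithTop.coe_lt_coe.mpr (lt_of_le_of_ne ?_ ?_)
        · refine (m.le_degree he).trans ((m.degree_sub_le).trans (sup_le ?_ ?_))
          · refine m.degree_mul_le.trans ?_
            simp
          · refine m.degree_mul_le.trans ?_
            rw [hβ, add_comm, map_add, map_add]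
            gcongr
            exact m.degree_monomial_le _
        · intro h
          rw [m.toSyn.injective.eq_iff] at h
          rw [mem_support_iff] at he
          apply he
          subst h
          have hc : coeff (m.degree w) (monomial β (m.leadingCoeff w) * f) =
              m.leadingCoeff w * m.leadingCoeff f := by
            rw [hβ, add_comm, coeff_monomial_mul]; rfl
          rw [coeff_sub, coeff_C_mul, hc, mul_comm]
          exact sub_self _)
      refine ⟨t * m.leadingCoeff f, M.mul_mem ht hlc, r, ?_, fun e he =>
        ⟨(hr' e he).1, (hr' e he).2.trans hs⟩⟩
      have : C (t * m.leadingCoeff f) * w - r =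
          (C t * (C (m.leadingCoeff f) * w - monomial β (m.leadingCoeff w) * f) - r) +
            C t * monomial β (m.leadingCoeff w) * f := by
        rw [C_mul]; ring
      rw [this]
      exact I.add_mem hr (I.mul_mem_left _ hf)
    · obtain ⟨t, ht, r, hr, hr'⟩ := ih _ hs (w - monomial (m.degree w) (m.leadingCoeff w)) (by
        intro e he
        refine WithTop.coe_lt_coe.mpr (lt_of_le_of_ne ?_ ?_)
        · refine (m.le_degree he).trans ((m.degree_sub_le).trans (sup_le le_rfl ?_))
          exact m.degree_monomial_le _
        · intro h
          rw [m.toSyn.injective.eq_iff] at h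
          rw [mem_support_iff] at he
          apply he
          subst h
          rw [coeff_sub, coeff_monomial, if_pos rfl]
          exact sub_self _)
      refine ⟨t, ht, r + C t * monomial (m.degree w) (m.leadingCoeff w), ?_, fun e he => ?_⟩
      · convert hr using 1
        ring
      · by_cases h : e ∈ r.support
        · exact ⟨(hr' e h).1, (hr' e h).2.trans hs⟩
        · have : e = m.degree w := by
            by_contra hne
            rw [mem_support_iff, coeff_add, notMem_support_iff.mp h, coeff_C_mul, coeff_monomial,
              if_neg (Ne.symm hne)] at he
            simp at he
          subst this
          exact ⟨hα, hs⟩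

/-! ### Leading exponents under specialisation -/

/-- Every element of `K` is a fraction of elements of the image of `R`. -/
def HasFractions {R K : Type*} [CommRing R] [Field K] (ρ : R →+* K) : Prop :=
  ∀ x : K, ∃ r s : R, ρ s ≠ 0 ∧ ρ s * x = ρ r

open MvPolynomial in
theorem HasFractions.exists_map_eq {σ R K : Type*} [CommRing R] [Field K] {ρ : R →+* K}
    (hρ : HasFractions ρ) (F : MvPolynomial σ K) :
    ∃ (s : R) (f : MvPolynomial σ R), ρ s ≠ 0 ∧ C (ρ s) * F = map ρ f := by
  induction F using MvPolynomial.induction_on with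
  | C x =>
    obtain ⟨r, s, hs, h⟩ := hρ x
    exact ⟨s, C r, hs, by rw [map_C, ← h, C_mul]⟩
  | add p q hp hq =>
    obtain ⟨s, f, hs, h⟩ := hp
    obtain ⟨s', f', hs', h'⟩ := hq
    refine ⟨s * s', C s' * f + C s * f', by simp [hs, hs'], ?_⟩
    simp only [map_add, map_mul, map_C, ← h, ← h']
    ring
  | mul_X p i hp =>
    obtain ⟨s, f, hs, h⟩ := hp
    exact ⟨s, f * X i, hs, by rw [map_mul, map_X, ← h, mul_assoc]⟩

open MvPolynomial in
theorem HasFractions.exists_mem_map_eq {σ R K : Type*} [CommRing R] [Field K] {ρ : R →+* K}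
    (hρ : HasFractions ρ) {I : Ideal (MvPolynomial σ R)} {F : MvPolynomial σ K}
    (hF : F ∈ I.map (map ρ)) :
    ∃ s, ρ s ≠ 0 ∧ ∃ f ∈ I, C (ρ s) * F = map ρ f := by
  induction hF using Submodule.span_induction with
  | mem x hx =>
    obtain ⟨f, hf, rfl⟩ := hx
    exact ⟨1, by simp, f, hf, by simp⟩
  | zero => exact ⟨1, by simp, 0, I.zero_mem, by simp⟩
  | add p q _ _ hp hq =>
    obtain ⟨s, hs, f, hf, h⟩ := hp
    obtain ⟨s', hs', f', hf', h'⟩ := hq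
    refine ⟨s * s', by simp [hs, hs'], C s' * f + C s * f',
      I.add_mem (I.mul_mem_left _ hf) (I.mul_mem_left _ hf'), ?_⟩
    simp only [map_add, map_mul, map_C, ← h, ← h']
    ring
  | smul a p _ hp =>
    obtain ⟨s, hs, f, hf, h⟩ := hp
    obtain ⟨s', g, hs', h'⟩ := hρ.exists_map_eq a
    refine ⟨s' * s, by simp [hs, hs'], g * f, I.mul_mem_left _ hf, ?_⟩
    simp only [map_mul, ← h, ← h', smul_eq_mul]
    ring

open MvPolynomial in
theorem C_dvd_of_map_eq_zero {σ R K : Type*} [CommRing R] [Field K] {ρ : R →+* K} {p : R}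
    (hp : RingHom.ker ρ = Ideal.span {p}) {f : MvPolynomial σ R} (hf : map ρ f = 0) :
    C p ∣ f := by
  rw [C_dvd_iff_dvd_coeff]
  intro e
  rw [← Ideal.mem_span_singleton, ← hp, RingHom.mem_ker, ← coeff_map, hf, coeff_zero]

/-- The leading exponents of the nonzero elements of an ideal, over a ring of coefficients. -/
def initialExponents {σ R : Type*} [CommRing R] (m : MonomialOrder σ)
    (I : Ideal (MvPolynomial σ R)) : Set (σ →₀ ℕ) :=
  {α | ∃ f ∈ I, f ≠ 0 ∧ m.degree f = α}

open MvPolynomial in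
theorem degree_map_of_leadingCoeff_ne_zero {σ R K : Type*} [CommRing R] [Field K]
    (m : MonomialOrder σ) {ρ : R →+* K} {f : MvPolynomial σ R} (hf : ρ (m.leadingCoeff f) ≠ 0) :
    map ρ f ≠ 0 ∧ m.degree (map ρ f) = m.degree f := by
  have h : m.degree f ∈ (map ρ f).support := by
    rwa [mem_support_iff, coeff_map]
  have h0 : map ρ f ≠ 0 := by
    intro h0
    rw [h0] at h
    exact absurd h (by simp)
  have hle : m.toSyn (m.degree (map ρ f)) ≤ m.toSyn (m.degree f) :=
    m.degree_le_iff.mpr fun e he => m.le_degree (support_map_subset _ _ he)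
  exact ⟨h0, m.toSyn.injective (le_antisymm hle (m.le_degree h))⟩

-- The danger is an h in I whose top terms die under ρ, uncovering a new leading exponent α. Write h
-- = h₁ + aX^α + pw with p generating ker ρ and h₁ supported below α. Dividing h₁ and w by I yields
-- an element of I with no initial exponent in its support. It must vanish, yet ρ does not kill its
-- coefficient at α.
open MvPolynomial in
theorem leadingExponents_map_eq {σ R K : Type*} [CommRing R] [IsDomain R] [IsPrincipalIdealRing R]
    [Field K] (m : MonomialOrder σ) (I : Ideal (MvPolynomial σ R)) {ρ : R →+* K}
    (hρ : HasFractions ρ)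
    (hI : ∀ α ∈ initialExponents m I, ∃ f ∈ I, ∃ β, α = m.degree f + β ∧
      ρ (m.leadingCoeff f) ≠ 0) :
    leadingExponents m (I.map (map ρ)) = initialExponents m I := by
  classical
  have key : ∀ r ∈ I, (∀ e ∈ r.support, e ∉ initialExponents m I) → r = 0 := by
    intro r hr h
    by_contra h0
    exact h _ (m.degree_mem_support h0) ⟨r, hr, h0, rfl⟩
  apply Set.Subset.antisymm
  · rintro α ⟨F, hF, hF0, rfl⟩
    by_contra hα
    obtain ⟨s, hs, h, hh, hsF⟩ := hρ.exists_mem_map_eq hF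
    have hCs : (C (ρ s) : MvPolynomial σ K) ≠ 0 := by simpa using hs
    have hdeg : m.degree (map ρ h) = m.degree F := by
      rw [← hsF, m.degree_mul hCs hF0, m.degree_C, zero_add]
    have hh0 : map ρ h ≠ 0 := by rw [← hsF]; exact mul_ne_zero hCs hF0
    rw [← hdeg] at hα
    obtain ⟨p, hp⟩ := (IsPrincipalIdealRing.principal (RingHom.ker ρ)).principal
    have hp' : ρ p = 0 := by
      rw [← RingHom.mem_ker, hp]; exact Submodule.mem_span_singleton_self p
    set α := m.degree (map ρ h) with hαdef
    have hαh : ρ (coeff α h) ≠ 0 := by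
      rw [← coeff_map]; exact m.coeff_degree_ne_zero_iff.mpr hh0
    -- the part of `h` that survives under `ρ`, without its leading term
    set h₁ : MvPolynomial σ R :=
      ∑ e ∈ (map ρ h).support.erase α, monomial e (coeff e h) with hh₁
    have hc : ∀ e, coeff e h₁ = if e ∈ (map ρ h).support.erase α then coeff e h else 0 := by
      intro e
      simp only [hh₁, coeff_sum, coeff_monomial, Finset.sum_ite_eq']
    obtain ⟨w, hw⟩ : C p ∣ h - (h₁ + monomial α (coeff α h)) := by
      refine C_dvd_of_map_eq_zero hp ?_
      ext e
      rw [coeff_map, coeff_sub, coeff_add, hc, coeff_monomial, coeff_zero]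
      by_cases h1 : e = α
      · subst h1; simp
      · by_cases h2 : ρ (coeff e h) = 0
        · rw [if_neg (Ne.symm h1), add_zero, map_sub, h2, zero_sub, neg_eq_zero]
          split_ifs <;> simp [h2]
        · rw [if_neg (Ne.symm h1), add_zero, if_pos, sub_self, map_zero]
          rw [Finset.mem_erase, mem_support_iff, coeff_map]
          exact ⟨h1, h2⟩
    let M : Submonoid R := Submonoid.comap ρ (nonZeroDivisors K)
    have hM : ∀ x, x ∈ M ↔ ρ x ≠ 0 := fun x => by
      rw [Submonoid.mem_comap, mem_nonZeroDivisors_iff_ne_zero]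
    have hI' : ∀ α ∈ initialExponents m I, ∃ f ∈ I, ∃ β, α = m.degree f + β ∧
        m.leadingCoeff f ∈ M := by simpa only [hM] using hI
    -- The bound keeps r strictly below α, so r cannot cancel the term at α. The remainder of w
    -- needs no bound, since it enters multiplied by p.
    obtain ⟨t, ht, r, hr, hrs⟩ := exists_remainder m I _ M hI' (m.toSyn α) h₁ (by
      intro e he
      rw [mem_support_iff, hc] at he
      have he' : e ∈ (map ρ h).support.erase α := by
        by_contra h; simp [h] at he
      rw [Finset.mem_erase] at he'
      exact WithTop.coe_lt_coe.mpr
        (lt_of_le_of_ne (m.le_degree he'.2) fun h => he'.1 (m.toSyn.injective h)))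
    obtain ⟨t', ht', r', hr', hrs'⟩ :=
      exists_remainder m I _ M hI' ⊤ w fun e _ => WithTop.coe_lt_top _
    rw [hM] at ht ht'
    have hzero := key (C t' * (r + C t * monomial α (coeff α h)) + C p * (C t * r')) (by
      have : C t' * (r + C t * monomial α (coeff α h)) + C p * (C t * r') =
          C (t * t') * h - C t' * (C t * h₁ - r) - C p * (C t * (C t' * w - r')) := by
        have : h = C p * w + (h₁ + monomial α (coeff α h)) := by rw [← hw]; ring
        conv_rhs => rw [this]
        simp only [C_mul]
        ring
      rw [this]
      exact I.sub_mem (I.sub_mem (I.mul_mem_left _ hh) (I.mul_mem_left _ hr))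
        (I.mul_mem_left _ (I.mul_mem_left _ hr'))) (by
      intro e he hes
      rw [mem_support_iff] at he
      apply he
      have h1 : coeff e r = 0 := by
        by_contra h; exact (hrs e (mem_support_iff.mpr h)).1 hes
      have h2 : coeff e r' = 0 := by
        by_contra h; exact (hrs' e (mem_support_iff.mpr h)).1 hes
      have h3 : α ≠ e := fun h => hα (h ▸ hes)
      simp [coeff_C_mul, coeff_monomial, h1, h2, h3])
    have hrα : coeff α r = 0 := by
      by_contra h; exact lt_irrefl _ (hrs α (mem_support_iff.mpr h)).2
    have := congrArg (fun f => ρ (coeff α f)) hzero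
    simp only [coeff_add, coeff_C_mul, hrα, coeff_monomial, if_true, zero_add, map_add, map_mul,
      hp', zero_mul, add_zero, coeff_zero, map_zero] at this
    exact mul_ne_zero ht' (mul_ne_zero ht hαh) this
  · intro α hα
    obtain ⟨f, hf, β, rfl, hlc⟩ := hI α hα
    obtain ⟨h0, hdeg⟩ := degree_map_of_leadingCoeff_ne_zero m hlc
    have hmon : (monomial β (1 : K)) ≠ 0 := by simp
    refine ⟨monomial β 1 * map ρ f, Ideal.mul_mem_left _ _ (Ideal.mem_map_of_mem _ hf),
      mul_ne_zero hmon h0, ?_⟩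
    rw [m.degree_mul hmon h0, hdeg, m.degree_monomial, if_neg one_ne_zero, add_comm]

theorem isStaircase_compl_initialExponents {σ R : Type*} [CommRing R] [IsDomain R]
    (m : MonomialOrder σ) (I : Ideal (MvPolynomial σ R)) :
    IsStaircase (initialExponents m I)ᶜ := by
  classical
  intro α hα β
  rw [Set.notMem_compl_iff] at hα ⊢
  obtain ⟨f, hf, hf0, rfl⟩ := hα
  have hmon : (MvPolynomial.monomial β (1 : R)) ≠ 0 := by simp
  refine ⟨MvPolynomial.monomial β 1 * f, I.mul_mem_left _ hf, mul_ne_zero hmon hf0, ?_⟩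
  rw [m.degree_mul hmon hf0, m.degree_monomial, if_neg one_ne_zero, add_comm]

/-- **Dickson's lemma**, in terms of finitely many generators. -/
theorem exists_finset_forall_exists_le {σ : Type*} [Finite σ] (S : Set (σ →₀ ℕ)) :
    ∃ T : Finset (σ →₀ ℕ), ↑T ⊆ S ∧ ∀ α ∈ S, ∃ β ∈ T, β ≤ α := by
  have hfin : {a | Minimal (· ∈ S) a}.Finite :=
    (setOfPred_minimal_antichain (· ∈ S)).finite_of_partiallyWellOrderedOn
      (Set.isPWO_of_wellQuasiOrderedLE _)
  refine ⟨hfin.toFinset, fun a ha => ?_, fun α hα => ?_⟩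
  · exact (hfin.mem_toFinset.mp ha).1
  · obtain ⟨b, hb, hb'⟩ := exists_minimal_le_of_wellFoundedLT (· ∈ S) α hα
    exact ⟨b, hfin.mem_toFinset.mpr hb', hb⟩

/-- Dickson's lemma reduces the condition on leading coefficients to finitely many elements of I,
and g is the product of theirs. It is chosen before K, so it serves all points at once. -/
theorem exists_standardSet_map_eq {σ R : Type*} [Finite σ] [CommRing R] [IsDomain R]
    [IsPrincipalIdealRing R] (m : MonomialOrder σ) (I : Ideal (MvPolynomial σ R)) :
    ∃ g : R, g ≠ 0 ∧ ∀ {K : Type*} [Field K] (ρ : R →+* K), HasFractions ρ → ρ g ≠ 0 →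
      standardSet m (I.map (MvPolynomial.map ρ)) = (initialExponents m I)ᶜ := by
  obtain ⟨T, hTS, hT⟩ := exists_finset_forall_exists_le (initialExponents m I)
  choose! f hf hf0 hdeg using fun α (hα : α ∈ T) => hTS hα
  refine ⟨∏ α ∈ T, m.leadingCoeff (f α), ?_, fun ρ hρ hg => ?_⟩
  · exact Finset.prod_ne_zero_iff.mpr fun α hα => m.leadingCoeff_ne_zero_iff.mpr (hf0 α hα)
  · rw [standardSet, leadingExponents_map_eq m I hρ]
    intro α hα
    obtain ⟨β, hβ, hle⟩ := hT α hα
    refine ⟨f β, hf β hβ, α - β, by rw [hdeg β hβ, add_tsub_cancel_of_le hle], ?_⟩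
    rw [map_prod, Finset.prod_ne_zero_iff] at hg
    exact hg β hβ
-- Generic radicality of fibres
/-- The `R`-torsion of a quotient of a Noetherian module over an `R`-algebra is killed by a single
nonzero element of the domain `R`. -/
theorem exists_ne_zero_forall_smul_mem {R S F : Type*} [CommRing R] [IsDomain R] [CommRing S]
    [Algebra R S] [AddCommGroup F] [Module S F] [IsNoetherian S F] (L : Submodule S F) :
    ∃ g : R, g ≠ 0 ∧ ∀ (r : R) (b : F), r ≠ 0 →
      algebraMap R S r • b ∈ L → algebraMap R S g • b ∈ L := by
  -- N r consists of the b with rb in L. If N g is maximal among those with r ≠ 0, then N g = N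
  -- (gr), which contains every b with rb in L.
  let N : R → Submodule S F := fun r => L.comap (LinearMap.lsmul S F (algebraMap R S r))
  obtain ⟨_, ⟨g, hg, rfl⟩, hmax⟩ :=
    set_has_maximal_iff_noetherian.mpr ‹IsNoetherian S F› (N '' {r | r ≠ 0})
      ⟨_, 1, one_ne_zero, rfl⟩
  refine ⟨g, hg, fun r b hr hb => ?_⟩
  have hle : N g ≤ N (g * r) := fun x hx => by
    have hx' : algebraMap R S g • x ∈ L := hx
    change algebraMap R S (g * r) • x ∈ L
    rw [mul_comm, map_mul, mul_smul]
    exact L.smul_mem _ hx'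
  have hmem : b ∈ N (g * r) := by
    change algebraMap R S (g * r) • b ∈ L
    rw [map_mul, mul_smul]
    exact L.smul_mem _ hb
  by_contra hcon
  exact hmax _ ⟨g * r, mul_ne_zero hg hr, rfl⟩
    (lt_of_le_of_ne hle fun h => hcon (show b ∈ N g from h ▸ hmem))

/-- The tuples which are congruent to a constant modulo the given ideals. -/
def congruentTuples {ι S : Type*} [CommRing S] (𝔭 : ι → Ideal S) : Submodule S (ι → S) where
  carrier := {b | ∃ h, ∀ i, b i - h ∈ 𝔭 i}
  zero_mem' := ⟨0, fun i => by simp⟩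
  add_mem' := by
    rintro a b ⟨x, hx⟩ ⟨y, hy⟩
    refine ⟨x + y, fun i => ?_⟩
    rw [Pi.add_apply, add_sub_add_comm]
    exact (𝔭 i).add_mem (hx i) (hy i)
  smul_mem' := by
    rintro c b ⟨x, hx⟩
    refine ⟨c * x, fun i => ?_⟩
    rw [Pi.smul_apply, smul_eq_mul, ← mul_sub]
    exact (𝔭 i).mul_mem_left _ (hx i)

open MvPolynomial in
/-- Let `I` be a finite intersection of kernels of retractions of `R[X]`. Over almost all points of
`Spec R`, the fibre of `I` is radical. -/
theorem exists_isRadical_map {σ R ι : Type*} [Finite σ] [Finite ι] [CommRing R] [IsDomain R]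
    [IsPrincipalIdealRing R] (𝔭 : ι → Ideal (MvPolynomial σ R))
    (φ : ι → MvPolynomial σ R →ₐ[R] MvPolynomial σ R) (hφ : ∀ i f, f - φ i f ∈ 𝔭 i)
    (hφ' : ∀ i, ∀ f ∈ 𝔭 i, φ i f = 0) :
    ∃ g : R, g ≠ 0 ∧ ∀ {K : Type*} [Field K] (ρ : R →+* K), HasFractions ρ → ρ g ≠ 0 →
      ((⨅ i, 𝔭 i).map (map ρ)).IsRadical := by
  obtain ⟨g, hg, hL⟩ := exists_ne_zero_forall_smul_mem (R := R) (congruentTuples 𝔭)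
  refine ⟨g, hg, fun {K} _ ρ hρ hρg F ⟨N, hN⟩ => ?_⟩
  obtain ⟨s, f, hs, hsf⟩ := hρ.exists_map_eq F
  obtain ⟨p, hp⟩ := (IsPrincipalIdealRing.principal (RingHom.ker ρ)).principal
  have hp' : ρ p = 0 := by
    rw [← RingHom.mem_ker, hp]; exact Submodule.mem_span_singleton_self p
  -- it is enough to treat the image of `f`
  suffices h : map ρ f ∈ (⨅ i, 𝔭 i).map (map ρ) by
    have : F = C (ρ s)⁻¹ * map ρ f := by
      rw [← hsf, ← mul_assoc, ← C_mul, inv_mul_cancel₀ hs, C_1, one_mul]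
    rw [this]
    exact Ideal.mul_mem_left _ _ h
  have hfN : (map ρ f) ^ N ∈ (⨅ i, 𝔭 i).map (map ρ) := by
    rw [← hsf, mul_pow]
    exact Ideal.mul_mem_left _ _ hN
  -- Each retraction descends to an endomorphism ψ over K that kills the fibre of the intersection.
  -- It sends the image of f to a nilpotent of a domain, hence to zero.
  have hdvd : ∀ i, C p ∣ φ i f := by
    intro i
    let ψ : MvPolynomial σ K →ₐ[K] MvPolynomial σ K := aeval fun j => map ρ (φ i (X j))
    have hψ : ∀ q, ψ (map ρ q) = map ρ (φ i q) := by
      intro q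
      induction q using MvPolynomial.induction_on with
      | C a =>
        rw [map_C, ← algebraMap_eq, ← algebraMap_eq, AlgHom.commutes, AlgHom.commutes,
          algebraMap_eq, algebraMap_eq, map_C]
      | add p q hp hq => simp only [map_add, hp, hq]
      | mul_X p j hp => simp only [map_mul, hp, map_X, ψ, aeval_X]
    have hker : (⨅ i, 𝔭 i).map (map ρ) ≤ RingHom.ker ψ := by
      rw [Ideal.map_le_iff_le_comap]
      intro q hq
      rw [Ideal.mem_comap, RingHom.mem_ker, hψ, hφ' i q ((Ideal.mem_iInf.mp hq) i), map_zero]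
    have h := hker hfN
    rw [RingHom.mem_ker, map_pow, hψ] at h
    exact C_dvd_of_map_eq_zero hp (eq_zero_of_pow_eq_zero h)
  -- If ρ is injective, every φ i f vanishes, so f already lies in the intersection.
  by_cases hp0 : p = 0
  · refine Ideal.mem_map_of_mem _ (Ideal.mem_iInf.mpr fun i => ?_)
    have h := hdvd i
    rw [hp0, C_0, zero_dvd_iff] at h
    simpa [h] using hφ i f
  -- With φ i f = p bᵢ, the tuple pb is congruent to the constant f, so b is torsion modulo
  -- `congruentTuples` and gb is congruent to some constant h. Then gf − ph lies in every 𝔭 i, and ρ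
  -- turns it into ρ(g) times the image of f.
  · choose b hb using hdvd
    obtain ⟨h, hh⟩ := hL p b hp0 ⟨f, fun i => by
      rw [Pi.smul_apply, smul_eq_mul, algebraMap_eq, ← hb, ← neg_sub]
      exact (𝔭 i).neg_mem (hφ i f)⟩
    have hmem : C g * f - C p * h ∈ ⨅ i, 𝔭 i := by
      refine Ideal.mem_iInf.mpr fun i => ?_
      have : C g * f - C p * h = C g * (f - φ i f) + C p * (C g * b i - h) := by
        rw [hb]; ring
      rw [this]
      exact (𝔭 i).add_mem ((𝔭 i).mul_mem_left _ (hφ i f)) ((𝔭 i).mul_mem_left _ (hh i))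
    have h := Ideal.mul_mem_left _ (C (ρ g)⁻¹) (Ideal.mem_map_of_mem (map ρ) hmem)
    rwa [map_sub, map_mul, map_mul, map_C, map_C, hp', C_0, zero_mul, sub_zero, ← mul_assoc,
      ← C_mul, inv_mul_cancel₀ hρg, C_1, one_mul] at h

/-! ### Planes as graphs -/

open MvPolynomial in
/-- A plane with free variables `X_j`, `j ∈ J`, is the graph of an affine map in these variables;
substituting it is a retraction whose kernel is the ideal of the plane. -/
theorem IsFreeVariables.exists_retraction {N : ℕ} {k : Type*} [Field k]
    {P : AffineSubspace k (Fin N → k)} {J : Finset (Fin N)} (hJ : IsFreeVariables P J) :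
    ∃ φ : MvPolynomial (Fin N) k →ₐ[k] MvPolynomial (Fin N) k, (∀ j ∈ J, φ (X j) = X j) ∧
      (∀ f, f - φ f ∈ PrimeSpectrum.vanishingIdeal (planeVariety P)) ∧
      ∀ f ∈ PrimeSpectrum.vanishingIdeal (planeVariety P), φ f = 0 := by
  classical
  -- The point y over the origin of k^J and the points z j over the unit vectors form an affine
  -- frame of P; φ substitutes the resulting parametrisation.
  obtain ⟨y, hy⟩ := hJ.2 0
  choose z hz using fun j : J => hJ.2 (Pi.single j 1)
  let v : J → Fin N → k := fun j i => (z j : Fin N → k) i - (y : Fin N → k) i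
  let φ : MvPolynomial (Fin N) k →ₐ[k] MvPolynomial (Fin N) k :=
    aeval fun i => C ((y : Fin N → k) i) + ∑ j : J, C (v j i) * X (j : Fin N)
  have hyJ : ∀ j : J, (y : Fin N → k) j = 0 := fun j => congrFun hy j
  have hzJ : ∀ j l : J, (z j : Fin N → k) l = (Pi.single j 1 : J → k) l :=
    fun j l => congrFun (hz j) l
  have hX : ∀ i, φ (X i) = C ((y : Fin N → k) i) + ∑ j : J, C (v j i) * X (j : Fin N) :=
    fun i => aeval_X _ _
  have hlin : ∀ i, X i - φ (X i) ∈
      {f : MvPolynomial (Fin N) k | f.totalDegree ≤ 1 ∧ ∀ x ∈ P, eval x f = 0} := by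
    intro i
    rw [hX]
    refine ⟨?_, fun x hx => ?_⟩
    · refine (totalDegree_sub _ _).trans (max_le (totalDegree_X i).le ?_)
      refine (totalDegree_add _ _).trans (max_le (by simp) ?_)
      refine totalDegree_finsetSum_le fun j _ => ?_
      refine (totalDegree_mul _ _).trans ?_
      simp
    · have hv : ∀ j, v j ∈ P.direction := fun j =>
        AffineSubspace.vsub_mem_direction (z j).2 y.2
      have hmem : (∑ j : J, x j • v j) + (y : Fin N → k) ∈ P :=
        AffineSubspace.vadd_mem_of_mem_direction
          (P.direction.sum_mem fun j _ => P.direction.smul_mem _ (hv j)) y.2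
      have heq : (⟨_, hmem⟩ : P) = ⟨x, hx⟩ := by
        apply hJ.1
        funext l
        simp only [Pi.add_apply, Finset.sum_apply, Pi.smul_apply, v, hyJ, hzJ, smul_eq_mul,
          Pi.single_apply, sub_zero, add_zero]
        simp
      have := congrFun (congrArg Subtype.val heq) i
      simp only [Pi.add_apply, Finset.sum_apply, Pi.smul_apply, smul_eq_mul] at this
      simp only [eval_sub, eval_X, eval_add, eval_C, eval_sum, eval_mul]
      rw [← this, sub_eq_zero, add_comm]
      congr 1
      exact Finset.sum_congr rfl fun j _ => mul_comm _ _
  have hspan : ∀ f, f - φ f ∈ Ideal.span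
      {f : MvPolynomial (Fin N) k | f.totalDegree ≤ 1 ∧ ∀ x ∈ P, eval x f = 0} := by
    intro f
    rw [← Ideal.Quotient.eq]
    have : (Ideal.Quotient.mkₐ k (Ideal.span
        {f : MvPolynomial (Fin N) k | f.totalDegree ≤ 1 ∧ ∀ x ∈ P, eval x f = 0})) =
        (Ideal.Quotient.mkₐ k _).comp φ := by
      refine MvPolynomial.algHom_ext fun i => ?_
      exact Ideal.Quotient.eq.mpr (Ideal.subset_span (hlin i))
    exact DFunLike.congr_fun this f
  let c : (Fin N → k) → MvPolynomial (Fin N) k →ₗ[k] MvPolynomial (Fin N) k :=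
    fun x => Algebra.linearMap k _ ∘ₗ (aeval x : MvPolynomial (Fin N) k →ₐ[k] k).toLinearMap
  have hc : ∀ x f, c x f = C (eval x f) := fun x f => by
    simp [c, algebraMap_eq, aeval_eq_eval]
  -- ψ f is the affine interpolation of the values of f at y and the z j. It agrees with φ in degree
  -- at most one, so φ kills the equations of P; comparing coefficients in this way is valid over
  -- finite fields too.
  let ψ : MvPolynomial (Fin N) k →ₗ[k] MvPolynomial (Fin N) k :=
    c y + ∑ j : J, LinearMap.mulRight k (X (j : Fin N)) ∘ₗ (c (z j) - c y)
  have hψ : ∀ f, ψ f = C (eval (y : Fin N → k) f) +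
      ∑ j : J, (C (eval (z j : Fin N → k) f) - C (eval (y : Fin N → k) f)) * X (j : Fin N) := by
    intro f
    simp [ψ, hc]
  have hφψ : ∀ f : MvPolynomial (Fin N) k, f.totalDegree ≤ 1 → φ f = ψ f := by
    intro f hf
    rw [f.as_sum, map_sum, map_sum]
    refine Finset.sum_congr rfl fun e he => ?_
    have hle : e.degree ≤ 1 := (le_totalDegree he).trans hf
    rcases Nat.le_one_iff_eq_zero_or_eq_one.mp hle with h | h
    · rw [Finsupp.degree_eq_zero_iff] at h
      subst h
      rw [hψ]
      change φ (C _) = _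
      simp only [monomial_zero', eval_C, sub_self, zero_mul, Finset.sum_const_zero, add_zero]
      exact φ.commutes _
    · obtain ⟨i, rfl⟩ := (Finsupp.sum_eq_one_iff e).mp h
      rw [hψ, ← mul_one (coeff _ f), ← C_mul_monomial]
      change φ (C _ * X i) = C (eval _ (C _ * X i)) +
        ∑ j : J, (C (eval _ (C _ * X i)) - C (eval _ (C _ * X i))) * _
      rw [map_mul, hX, ← algebraMap_eq, φ.commutes, algebraMap_eq]
      simp only [eval_mul, eval_C, eval_X, C_mul, mul_add, Finset.mul_sum, v, C_sub]
      congr 1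
      exact Finset.sum_congr rfl fun j _ => by ring
  refine ⟨φ, fun j hj => ?_, fun f => ?_, fun f hf => ?_⟩
  · rw [hX, hyJ ⟨j, hj⟩, C_0, zero_add, Finset.sum_eq_single ⟨j, hj⟩]
    · simp only [v]
      rw [hyJ ⟨j, hj⟩, hzJ _ ⟨j, hj⟩]
      simp
    · intro l _ hl
      simp only [v]
      rw [hyJ ⟨j, hj⟩, hzJ _ ⟨j, hj⟩, Pi.single_eq_of_ne hl.symm]
      simp
    · simp
  · rw [planeVariety, ← PrimeSpectrum.zeroLocus_span,
      PrimeSpectrum.vanishingIdeal_zeroLocus_eq_radical]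
    exact Ideal.le_radical (hspan f)
  · rw [planeVariety, ← PrimeSpectrum.zeroLocus_span,
      PrimeSpectrum.vanishingIdeal_zeroLocus_eq_radical] at hf
    obtain ⟨M, hM⟩ := hf
    have hker : Ideal.span
        {f : MvPolynomial (Fin N) k | f.totalDegree ≤ 1 ∧ ∀ x ∈ P, eval x f = 0} ≤
          RingHom.ker φ := by
      rw [Ideal.span_le]
      intro q hq
      rw [SetLike.mem_coe, RingHom.mem_ker, hφψ q hq.1, hψ, hq.2 _ y.2, C_0, zero_add]
      refine Finset.sum_eq_zero fun j _ => ?_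
      rw [hq.2 _ (z j).2, C_0, sub_self, zero_mul]
    have h := hker hM
    rw [RingHom.mem_ker, map_pow] at h
    exact eq_zero_of_pow_eq_zero h
-- Separating the first variable
/-- `k[X_0, …, X_n]` as the polynomial ring in `X_1, …, X_n` over `k[X_0]`. -/
noncomputable def separateFirst (n : ℕ) (k : Type*) [Field k] :
    MvPolynomial (Fin (n + 1)) k ≃ₐ[k] MvPolynomial (Fin n) (Polynomial k) :=
  (MvPolynomial.renameEquiv k (finSuccEquiv n)).trans (MvPolynomial.optionEquivRight k (Fin n))

theorem separateFirst_X_zero (n : ℕ) (k : Type*) [Field k] :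
    separateFirst n k (MvPolynomial.X 0) = MvPolynomial.C Polynomial.X := by
  simp [separateFirst]

theorem separateFirst_X_succ (n : ℕ) (k : Type*) [Field k] (i : Fin n) :
    separateFirst n k (MvPolynomial.X i.succ) = MvPolynomial.X i := by
  simp [separateFirst]

theorem separateFirst_C (n : ℕ) (k : Type*) [Field k] (c : k) :
    separateFirst n k (MvPolynomial.C c) = MvPolynomial.C (Polynomial.C c) := by
  simp [separateFirst]

theorem map_separateFirst {n : ℕ} {k K : Type*} [Field k] [Field K] [Algebra k K] (a : K)
    (f : MvPolynomial (Fin (n + 1)) k) :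
    MvPolynomial.map (Polynomial.aeval a : Polynomial k →ₐ[k] K).toRingHom (separateFirst n k f) =
      substFirst n k a f := by
  induction f using MvPolynomial.induction_on with
  | C c =>
    rw [separateFirst_C, MvPolynomial.map_C, substFirst, MvPolynomial.aeval_C]
    simp [MvPolynomial.algebraMap_apply]
  | add p q hp hq => rw [map_add, map_add, map_add, hp, hq]
  | mul_X p i hp =>
    rw [map_mul, map_mul, map_mul, hp]
    congr 1
    refine Fin.cases ?_ (fun i => ?_) i
    · rw [separateFirst_X_zero, MvPolynomial.map_C, substFirst, MvPolynomial.aeval_X]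
      simp
    · rw [separateFirst_X_succ, MvPolynomial.map_X, substFirst, MvPolynomial.aeval_X]
      simp

theorem map_substFirst_eq {n : ℕ} {k K : Type*} [Field k] [Field K] [Algebra k K] (a : K)
    (I : Ideal (MvPolynomial (Fin (n + 1)) k)) :
    I.map (substFirst n k a).toRingHom =
      (I.map (separateFirst n k).toRingEquiv.toRingHom).map
        (MvPolynomial.map (Polynomial.aeval a : Polynomial k →ₐ[k] K).toRingHom) := by
  rw [Ideal.map_map]
  congr 1
  exact RingHom.ext fun f => (map_separateFirst a f).symm

/-- Substituting for the variables other than `X_0`, as a homomorphism of `k[X_0]`-algebras. -/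
noncomputable def separateHom {n : ℕ} {k : Type*} [Field k]
    (φ : MvPolynomial (Fin (n + 1)) k →ₐ[k] MvPolynomial (Fin (n + 1)) k) :
    MvPolynomial (Fin n) (Polynomial k) →ₐ[Polynomial k] MvPolynomial (Fin n) (Polynomial k) :=
  MvPolynomial.aeval fun i => separateFirst n k (φ (MvPolynomial.X i.succ))

theorem separateHom_separateFirst {n : ℕ} {k : Type*} [Field k]
    {φ : MvPolynomial (Fin (n + 1)) k →ₐ[k] MvPolynomial (Fin (n + 1)) k}
    (hφ : φ (MvPolynomial.X 0) = MvPolynomial.X 0) (f : MvPolynomial (Fin (n + 1)) k) :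
    separateHom φ (separateFirst n k f) = separateFirst n k (φ f) := by
  induction f using MvPolynomial.induction_on with
  | C c =>
    rw [MvPolynomial.algHom_C, MvPolynomial.algebraMap_eq, separateFirst_C, MvPolynomial.algHom_C,
      MvPolynomial.algebraMap_eq]
  | add p q hp hq => simp only [map_add, hp, hq]
  | mul_X p i hp =>
    simp only [map_mul, hp]
    refine congrArg (_ * ·) ?_
    refine Fin.cases ?_ (fun i => ?_) i
    · rw [hφ, separateFirst_X_zero, MvPolynomial.algHom_C, MvPolynomial.algebraMap_eq]
    · rw [separateFirst_X_succ, separateHom, MvPolynomial.aeval_X]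

/-- I(A) is the intersection of the ideals of its finitely many components. Because 0 ∈ J, each
retraction fixes X_0 and is therefore k[X_0]-linear, as the radicality criterion requires. -/
theorem IsFamilyOfPlanes.exists_isRadical {n d : ℕ} {k : Type*} [Field k]
    {A : Set (PrimeSpectrum (MvPolynomial (Fin (n + 1)) k))} (hA : IsFamilyOfPlanes d A) :
    ∃ g : Polynomial k, g ≠ 0 ∧ ∀ {K : Type*} [Field K] (ρ : Polynomial k →+* K),
      HasFractions ρ → ρ g ≠ 0 →
      (((PrimeSpectrum.vanishingIdeal A).map (separateFirst n k).toRingEquiv.toRingHom).map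
        (MvPolynomial.map ρ)).IsRadical := by
  have : Finite (irreducibleComponents A) :=
    TopologicalSpace.NoetherianSpace.finite_irreducibleComponents.to_subtype
  choose P J hZ _ hJ h0 using fun Z : irreducibleComponents A => hA.2 Z Z.2
  choose φ hφX hφ hφ' using fun Z => (hJ Z).1.exists_retraction
  have hI : PrimeSpectrum.vanishingIdeal A =
      ⨅ Z, PrimeSpectrum.vanishingIdeal (planeVariety (P Z)) := by
    rw [← PrimeSpectrum.vanishingIdeal_iUnion]
    congr 1
    simp_rw [← hZ, ← Set.image_iUnion]
    rw [← Set.sUnion_eq_iUnion, sUnion_irreducibleComponents, Set.image_univ, Subtype.range_coe]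
  let e := separateFirst n k
  obtain ⟨g, hg, h⟩ := exists_isRadical_map
    (fun Z => (PrimeSpectrum.vanishingIdeal (planeVariety (P Z))).comap e.symm.toRingEquiv.toRingHom)
    (fun Z => separateHom (φ Z))
    (fun Z f => by
      obtain ⟨f, rfl⟩ := e.surjective f
      rw [separateHom_separateFirst (hφX Z 0 (h0 Z)), ← map_sub, Ideal.mem_comap]
      convert hφ Z f
      exact e.symm_apply_apply _)
    (fun Z f hf => by
      obtain ⟨f, rfl⟩ := e.surjective f
      rw [Ideal.mem_comap] at hf
      have hf' : f ∈ PrimeSpectrum.vanishingIdeal (planeVariety (P Z)) := by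
        convert hf
        exact (e.symm_apply_apply _).symm
      rw [separateHom_separateFirst (hφX Z 0 (h0 Z)), hφ' Z f hf', map_zero])
  refine ⟨g, hg, fun ρ hρ hρg => ?_⟩
  convert h ρ hρ hρg using 2
  rw [hI, ← Ideal.comap_iInf]
  exact Ideal.map_comap_of_equiv e.toRingEquiv

theorem vanishingIdeal_slice {n : ℕ} {k K : Type*} [Field k] [Field K] [Algebra k K]
    {A : Set (PrimeSpectrum (MvPolynomial (Fin (n + 1)) k))} (hA : IsClosed A) (a : K) :
    PrimeSpectrum.vanishingIdeal (slice A a) =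
      ((PrimeSpectrum.vanishingIdeal A).map (substFirst n k a).toRingHom).radical := by
  have h : A = PrimeSpectrum.zeroLocus (PrimeSpectrum.vanishingIdeal A : Set _) := by
    rw [PrimeSpectrum.zeroLocus_vanishingIdeal_eq_closure, hA.closure_eq]
  rw [slice]
  conv_lhs => rw [h]
  rw [PrimeSpectrum.preimage_comap_zeroLocus, ← PrimeSpectrum.zeroLocus_span,
    PrimeSpectrum.vanishingIdeal_zeroLocus_eq_radical]
  rfl

/-! ### Points of the line and conclusion -/

theorem HasFractions.of_surjective {R K : Type*} [CommRing R] [Field K] {ρ : R →+* K}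
    (h : Function.Surjective ρ) : HasFractions ρ := fun x => by
  obtain ⟨r, rfl⟩ := h x
  exact ⟨r, 1, by simp, by simp⟩

/-- The residue field is the fraction field of R/p. Working with fractions instead of surjectivity
treats the generic point together with the closed ones. -/
theorem hasFractions_residueField {R : Type*} [CommRing R] (p : Ideal R) [p.IsPrime] :
    HasFractions (algebraMap R p.ResidueField) := by
  intro x
  obtain ⟨r, s, hs, rfl⟩ := IsFractionRing.div_surjective (A := R ⧸ p) x
  obtain ⟨r, rfl⟩ := Ideal.Quotient.mk_surjective r
  obtain ⟨s, rfl⟩ := Ideal.Quotient.mk_surjective s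
  have hs' : algebraMap R p.ResidueField s ≠ 0 := by
    rw [ne_eq, Ideal.algebraMap_residueField_eq_zero, ← Ideal.Quotient.eq_zero_iff_mem]
    exact nonZeroDivisors.ne_zero hs
  refine ⟨r, s, hs', ?_⟩
  rw [Ideal.algebraMap_quotient_residueField_mk, Ideal.algebraMap_quotient_residueField_mk,
    mul_div_cancel₀ _ hs']

theorem aeval_coordinateAt {k : Type*} [Field k] (p : PrimeSpectrum (Polynomial k)) :
    (Polynomial.aeval (coordinateAt p) : Polynomial k →ₐ[k] p.asIdeal.ResidueField).toRingHom =
      algebraMap (Polynomial k) p.asIdeal.ResidueField := by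
  have : (Polynomial.aeval (coordinateAt p) : Polynomial k →ₐ[k] p.asIdeal.ResidueField) =
      IsScalarTower.toAlgHom k (Polynomial k) p.asIdeal.ResidueField := by
    apply Polynomial.algHom_ext
    rw [Polynomial.aeval_X]
    rfl
  rw [this]
  rfl

theorem proposition5p1 {k : Type*} [Field k] (n d : ℕ)
    (m : MonomialOrder (Fin (n + 1)))
    (hm : StrictMono fun i : Fin (n + 1) => m.toSyn (Finsupp.single i 1))
    (A : Set (PrimeSpectrum (MvPolynomial (Fin (n + 1)) k)))
    (hA : IsFamilyOfPlanes d A) :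
    ∃ (U : Set (PrimeSpectrum (Polynomial k))) (δ : Set (Fin n →₀ ℕ)),
      IsOpen U ∧ U.Nonempty ∧ IsStaircase δ ∧
      (∀ p ∈ U, sliceStandardSet m A (coordinateAt p) = δ ∧
        fibreStandardSet m A (coordinateAt p) = δ) ∧
      (∀ c : k, rationalPoint c ∈ U → sliceStandardSet m A c = δ ∧
        fibreStandardSet m A c = δ) := by
  set I := (PrimeSpectrum.vanishingIdeal A).map (separateFirst n k).toRingEquiv.toRingHom with hI
  obtain ⟨g, hg, hrad⟩ := hA.exists_isRadical
  obtain ⟨g', hg', hstd⟩ := exists_standardSet_map_eq (restrictOrder m) I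
  have main : ∀ {K : Type _} [Field K] [Algebra k K] (a : K),
      HasFractions (Polynomial.aeval a : Polynomial k →ₐ[k] K).toRingHom →
      (Polynomial.aeval a : Polynomial k →ₐ[k] K).toRingHom (g * g') ≠ 0 →
      sliceStandardSet m A a = (initialExponents (restrictOrder m) I)ᶜ ∧
        fibreStandardSet m A a = (initialExponents (restrictOrder m) I)ᶜ := by
    intro K _ _ a ha hga
    rw [map_mul] at hga
    -- Slice and fibre ideals differ only by a radical, which is superfluous where g does not
    -- vanish; the two claims become one.
    rw [sliceStandardSet, fibreStandardSet, vanishingIdeal_slice hA.1, map_substFirst_eq,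
      (hrad _ ha (left_ne_zero_of_mul hga)).radical, and_self]
    exact hstd _ ha (right_ne_zero_of_mul hga)
  refine ⟨PrimeSpectrum.basicOpen (g * g'), (initialExponents (restrictOrder m) I)ᶜ,
    (PrimeSpectrum.basicOpen (g * g')).isOpen, ⟨⊥, ?_⟩,
    isStaircase_compl_initialExponents _ _, fun p hp => main _ ?_ ?_, fun c hc => main _ ?_ ?_⟩
  -- The generic point lies in U because g g' is nonzero.
  · exact mul_ne_zero hg hg'
  · rw [aeval_coordinateAt]
    exact hasFractions_residueField _
  · rw [aeval_coordinateAt, ne_eq, Ideal.algebraMap_residueField_eq_zero]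
    exact hp
  · exact HasFractions.of_surjective fun x => ⟨Polynomial.C x, by simp⟩
  · intro h
    -- If g g' vanished at c, then T − c would divide it, so the point would lie outside U.
    refine hc (Ideal.mem_span_singleton.mpr (Polynomial.dvd_iff_isRoot.mpr ?_))
    simpa [Polynomial.IsRoot, Polynomial.coe_aeval_eq_eval] using h
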